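/- For $n\in\mathbb{N}$ let $P_n(x)=\frac{1}{2^n n!}\frac{d^n}{dx^n}(x^2-1)^n$ be the $n$-th Legendre polynomial and, for $n\ge 1$, let $$\mathcal{G}_n(f)=\sum_{i=1}^n w_i f(x_i),\qquad w_i=\frac{2(1-x_i^2)}{(n+1)^2\,P_{n+1}(x_i)^2},$$ be the $n$-point Gauss--Legendre quadrature, where $x_1,\dots,x_n\in(-1,1)$ are the (real, distinct) roots of $P_n$. For $n\ge 1$ put $$\alpha_{2n}=\frac{4^{n+1}(n!)^4}{(2n+1)\,[(2n)!]^3},\qquad \alpha_{2n+1}=\frac{4^{n+1}(n+1)(n!)^4}{[(2n+1)!]^3},$$ and for a continuous function $g$ on $[-1,1]$ let $\|g\|=\sup\{|g(x)| : x\in[-1,1]\}$. Proposition. Let $k,N\in\mathbb{N}$ with $k\ge 2$ and $N>\lfloor k/2\rfloor$. Then $k\le 2N-1$, and for every $f\in C^k([-1,1])$, $$\left|\int_{-1}^1 f(x)\,dx-\mathcal{G}_N(f)\right|\le \alpha_k\,\|f^{(k)}\|.$$ (In particular, the bound needs only $k\le 2N-1$ derivatives rather than $2N$.) -/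

import Mathlib

namespace GaussLegendre

noncomputable section

/-- The `n`-th Legendre polynomial over `ℝ`, by the Rodrigues formula
`P_n = (2 ^ n * n!)⁻¹ * (d/dx) ^ n (x ^ 2 - 1) ^ n`. -/
def legendre (n : ℕ) : Polynomial ℝ :=
  Polynomial.C (((2 : ℝ) ^ n * (n.factorial : ℝ))⁻¹) *
    Polynomial.derivative^[n] ((Polynomial.X ^ 2 - 1) ^ n)

/-- The abscissas of the `n`-point Gauss–Legendre quadrature: the real roots of `P_n`. -/
def nodes (n : ℕ) : Finset ℝ :=
  (legendre n).roots.toFinset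

/-- The weight of the `n`-point Gauss–Legendre quadrature at the abscissa `x`. -/
def weight (n : ℕ) (x : ℝ) : ℝ :=
  2 * (1 - x ^ 2) / (((n : ℝ) + 1) ^ 2 * ((legendre (n + 1)).eval x) ^ 2)

/-- The `n`-point Gauss–Legendre quadrature `G_n(f)`. -/
def gaussQuad (n : ℕ) (f : ℝ → ℝ) : ℝ :=
  ∑ x ∈ nodes n, weight n x * f x

/-- The supremum norm of `f` on `[-1, 1]`. -/
def supNorm (f : ℝ → ℝ) : ℝ :=
  sSup ((fun x => |f x|) '' Set.Icc (-1 : ℝ) 1)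

/-- `α_{2n}`. -/
def alphaEven (n : ℕ) : ℝ :=
  4 ^ (n + 1) * (n.factorial : ℝ) ^ 4 /
    ((2 * (n : ℝ) + 1) * ((2 * n).factorial : ℝ) ^ 3)

/-- `α_{2n+1}`. -/
def alphaOdd (n : ℕ) : ℝ :=
  4 ^ (n + 1) * ((n : ℝ) + 1) * (n.factorial : ℝ) ^ 4 / ((2 * n + 1).factorial : ℝ) ^ 3

/-- The constants `α_k`; here `k / 2 = n` both for `k = 2n` and for `k = 2n + 1`. -/
def alpha (k : ℕ) : ℝ :=
  if Even k then alphaEven (k / 2) else alphaOdd (k / 2)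

end

end GaussLegendre

open Polynomial

namespace GaussLegendre

/-! Interpolate `f` at `k` distinct points of `[-1, 1]` by `H` of degree below `k`. Since `G_N`
integrates `H` exactly, the error for `f` equals the error for `f - H`. Lagrange's remainder and the
nonnegativity of the weights bound it by `M / k!` times `∫ |Q| + G_N(|Q|)`, where `Q` is the monic
nodal polynomial and `M` bounds `|f^(k)|` (`abs_error_le_of_nodes`). If moreover `Q ≥ 0` on `[-1,
1]`, then `deg Q = k < 2N` makes `G_N(Q) = ∫ Q`, and the bound becomes `2 M / k! * ∫ Q`.

A nonnegative `Q` needs interior nodes to be double. `abs_error_le_of_double_nodes` obtains them as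
limits of pairs `y, y + ε` of simple nodes, so Hermite interpolation is avoided. The constants come
from the orthogonal choices: for `k = 2n`, `Q` is the square of the monic `P_n`; for `k = 2n + 1`,
`Q = (x + 1) * D ^ 2` with `D` the monic multiple of `(P_n + P_{n+1}) / (x + 1)` (Gauss–Radau). In
both cases `∫ Q` is explicit from the norm and leading coefficients of Legendre polynomials.

The remaining work is classical: `roots_of_orthogonal` supplies the nodes, and `weight_eq`
identifies the given weights with the interpolatory ones, which yields exactness. -/

/-! ### Integration of polynomials over `[-1, 1]` -/

/-- The integral of a polynomial over `[-1, 1]`, as a linear form. -/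
noncomputable def polyIntegral : ℝ[X] →ₗ[ℝ] ℝ where
  toFun p := ∫ x in (-1 : ℝ)..1, p.eval x
  map_add' p q := by
    simp only [eval_add]
    exact intervalIntegral.integral_add (p.continuous.intervalIntegrable _ _)
      (q.continuous.intervalIntegrable _ _)
  map_smul' c p := by
    simp only [eval_smul, smul_eq_mul, RingHom.id_apply]
    exact intervalIntegral.integral_const_mul _ _

lemma polyIntegral_apply (p : ℝ[X]) : polyIntegral p = ∫ x in (-1 : ℝ)..1, p.eval x := rfl

lemma polyIntegral_C_mul (c : ℝ) (p : ℝ[X]) : polyIntegral (C c * p) = c * polyIntegral p := by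
  rw [← smul_eq_C_mul, map_smul, smul_eq_mul]

lemma polyIntegral_derivative (p : ℝ[X]) :
    polyIntegral (derivative p) = p.eval 1 - p.eval (-1) := by
  rw [polyIntegral_apply]
  exact intervalIntegral.integral_eq_sub_of_hasDerivAt (fun x _ => p.hasDerivAt x)
    ((derivative p).continuous.intervalIntegrable _ _)

lemma polyIntegral_pos {p : ℝ[X]} (hp : p ≠ 0)
    (h : ∀ x ∈ Set.Icc (-1 : ℝ) 1, 0 ≤ p.eval x) : 0 < polyIntegral p := by
  rw [polyIntegral_apply]
  refine intervalIntegral.integral_pos (by norm_num) p.continuous.continuousOn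
    (fun x hx => h x ⟨hx.1.le, hx.2⟩) ?_
  by_contra! hc
  refine hp (eq_zero_of_infinite_isRoot p ((Set.Icc_infinite (by norm_num : (-1 : ℝ) < 1)).mono ?_))
  exact fun x hx => le_antisymm (hc x hx) (h x hx)

lemma polyIntegral_ne_zero_of_sign {p : ℝ[X]} (hp : p ≠ 0)
    (h : (∀ x ∈ Set.Icc (-1 : ℝ) 1, 0 ≤ p.eval x) ∨ ∀ x ∈ Set.Icc (-1 : ℝ) 1, p.eval x ≤ 0) :
    polyIntegral p ≠ 0 := by
  rcases h with h | h
  · exact (polyIntegral_pos hp h).ne'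
  · have := polyIntegral_pos (neg_ne_zero.2 hp) (fun x hx => by simpa using h x hx)
    rw [map_neg] at this
    linarith

/-! ### Legendre polynomials: orthogonality, identities, norm -/

/-- An iterated derivative of `(X ^ 2 - 1) ^ n` of order below `n` vanishes at `±1`. -/
lemma eval_iterate_derivative_eq_zero {m n : ℕ} (h : m < n) {a : ℝ} (ha : a ^ 2 = 1) :
    (derivative^[m] ((X ^ 2 - 1 : ℝ[X]) ^ n)).eval a = 0 := by
  have h1 := pow_sub_dvd_iterate_derivative_pow (X ^ 2 - 1 : ℝ[X]) n m
  obtain ⟨r, hr⟩ := (dvd_pow_self (X ^ 2 - 1 : ℝ[X]) (Nat.sub_ne_zero_of_lt h)).trans h1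
  simp [hr, ha]

/-- Repeated integration by parts: each step lowers the degree of `g`, and the boundary terms vanish
because fewer than `n` derivatives fall on `(X ^ 2 - 1) ^ n`. -/
lemma polyIntegral_iterate_derivative_mul {m n : ℕ} (hm : m ≤ n) (g : ℝ[X]) (hg : g.degree < m) :
    polyIntegral (derivative^[m] ((X ^ 2 - 1 : ℝ[X]) ^ n) * g) = 0 := by
  induction m generalizing g with
  | zero =>
    have : g = 0 := by simpa using hg
    simp [this]
  | succ m ih =>
    have hg' : (derivative g).degree < m := by
      by_cases h0 : g = 0
      · simp [h0]
      · rcases Nat.eq_zero_or_pos g.natDegree with h1 | h1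
        · rw [eq_C_of_natDegree_eq_zero h1]; simp
        · have h2 := (natDegree_lt_iff_degree_lt h0).2 hg
          refine lt_of_le_of_lt (degree_le_natDegree) ?_
          have := natDegree_derivative_le g
          exact_mod_cast (by omega : (derivative g).natDegree < m)
    have key : derivative^[m + 1] ((X ^ 2 - 1 : ℝ[X]) ^ n) * g
        = derivative (derivative^[m] ((X ^ 2 - 1 : ℝ[X]) ^ n) * g)
          - derivative^[m] ((X ^ 2 - 1 : ℝ[X]) ^ n) * derivative g := by
      rw [Function.iterate_succ_apply', derivative_mul]; ring
    rw [key, map_sub, ih (by omega) _ hg', polyIntegral_derivative, eval_mul, eval_mul,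
      eval_iterate_derivative_eq_zero (by omega) (by norm_num),
      eval_iterate_derivative_eq_zero (by omega) (by norm_num)]
    simp

/-- `P_n` is orthogonal to the polynomials of degree below `n`. -/
lemma polyIntegral_legendre_mul {n : ℕ} {g : ℝ[X]} (hg : g.degree < n) :
    polyIntegral (legendre n * g) = 0 := by
  rw [legendre, mul_assoc, polyIntegral_C_mul, polyIntegral_iterate_derivative_mul le_rfl g hg,
    mul_zero]

/-- Leibniz' rule for `X * p`. -/
lemma iterate_derivative_succ_X_mul (n : ℕ) (p : ℝ[X]) :
    derivative^[n + 1] (X * p) =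
      X * derivative^[n + 1] p + ((n : ℝ[X]) + 1) * derivative^[n] p := by
  rw [mul_comm, iterate_derivative_mul_X]
  simp only [nsmul_eq_mul, Nat.add_sub_cancel]
  push_cast
  ring

lemma derivative_sq_sub_one_pow (n : ℕ) :
    derivative ((X ^ 2 - 1 : ℝ[X]) ^ (n + 1)) =
      C (2 * ((n : ℝ) + 1)) * (X * (X ^ 2 - 1) ^ n) := by
  rw [derivative_pow_succ]
  simp only [derivative_sub, derivative_X_pow, derivative_one, C_mul, C_add, C_1, map_natCast,
    map_ofNat]
  norm_num
  ring

/-- One derivative of `(X ^ 2 - 1) ^ (n + 2)` produces a factor `X`, to which Leibniz' rule applies.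
The correction term vanishes at `±1`, which gives the endpoint values. -/
lemma legendre_succ_succ (n : ℕ) :
    legendre (n + 2) = X * legendre (n + 1) +
      C (((2 : ℝ) ^ (n + 1) * (n.factorial : ℝ))⁻¹) *
        derivative^[n] ((X ^ 2 - 1) ^ (n + 1)) := by
  have h1 : derivative^[n + 2] ((X ^ 2 - 1 : ℝ[X]) ^ (n + 2)) =
      C (2 * ((n : ℝ) + 2)) * (X * derivative^[n + 1] ((X ^ 2 - 1) ^ (n + 1)) +
        ((n : ℝ[X]) + 1) * derivative^[n] ((X ^ 2 - 1) ^ (n + 1))) := by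
    rw [Function.iterate_succ_apply, derivative_sq_sub_one_pow, iterate_derivative_C_mul,
      iterate_derivative_succ_X_mul]
    push_cast
    congr 2
    ring
  have h2 : (n.factorial : ℝ) ≠ 0 := by positivity
  have h3 : ((n : ℝ[X]) + 1) = C ((n : ℝ) + 1) := by simp
  have e1 : ((2 : ℝ) ^ (n + 2) * ((n + 2).factorial : ℝ))⁻¹ * (2 * ((n : ℝ) + 2)) =
      ((2 : ℝ) ^ (n + 1) * ((n + 1).factorial : ℝ))⁻¹ := by
    simp only [Nat.factorial_succ]; push_cast; field_simp; ring
  have e2 : ((2 : ℝ) ^ (n + 1) * ((n + 1).factorial : ℝ))⁻¹ * ((n : ℝ) + 1) =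
      ((2 : ℝ) ^ (n + 1) * (n.factorial : ℝ))⁻¹ := by
    simp only [Nat.factorial_succ]; push_cast; field_simp
  rw [legendre, legendre, h1, ← mul_assoc, ← C_mul, e1, h3, ← e2, C_mul]
  ring

/-- Obtained by differentiating `(X ^ 2 - 1) * u' = 2 (n + 1) X u` exactly `n + 1` times. At a node
it trades the derivative of `legendre (n + 1)` for the value of `legendre (n + 2)`, which is what
the weight formula contains. -/
lemma sq_sub_one_mul_derivative_legendre (n : ℕ) :
    (X ^ 2 - 1) * derivative (legendre (n + 1)) =
      C ((n : ℝ) + 2) * (legendre (n + 2) - X * legendre (n + 1)) := by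
  set u : ℝ[X] := (X ^ 2 - 1) ^ (n + 1) with hu
  have h1 : (X ^ 2 - 1) * derivative u = C (2 * ((n : ℝ) + 1)) * (X * u) := by
    rw [hu, derivative_sq_sub_one_pow, pow_succ]; ring
  have hs : ∀ m : ℕ, derivative^[m] (derivative u) = derivative^[m + 1] u := fun m =>
    (Function.iterate_succ_apply _ _ _).symm
  have h2 := congrArg (derivative^[n + 1]) h1
  rw [iterate_derivative_C_mul, iterate_derivative_succ_X_mul, sub_mul, iterate_derivative_sub,
    one_mul, pow_two, mul_assoc, iterate_derivative_succ_X_mul, iterate_derivative_succ_X_mul,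
    hs] at h2
  have h3 : derivative^[n] (X * derivative u) =
      X * derivative^[n + 1] u + (n : ℝ[X]) * derivative^[n] u := by
    cases n with
    | zero => simp
    | succ m => rw [iterate_derivative_succ_X_mul, hs, hs]; push_cast; ring
  rw [h3, hs] at h2
  have h4 : (X ^ 2 - 1) * derivative^[n + 2] u =
      C ((n : ℝ) + 2) * (C ((n : ℝ) + 1) * derivative^[n] u) := by
    simp only [C_mul, C_add, C_1, map_natCast, map_ofNat] at h2 ⊢
    linear_combination h2
  have e2 : ((2 : ℝ) ^ (n + 1) * ((n + 1).factorial : ℝ))⁻¹ * ((n : ℝ) + 1) =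
      ((2 : ℝ) ^ (n + 1) * (n.factorial : ℝ))⁻¹ := by
    simp only [Nat.factorial_succ]; push_cast; field_simp
  rw [legendre_succ_succ, add_sub_cancel_left, legendre, derivative_C_mul,
    ← Function.iterate_succ_apply' derivative, ← hu, ← e2, C_mul]
  linear_combination C (((2 : ℝ) ^ (n + 1) * ((n + 1).factorial : ℝ))⁻¹) * h4

lemma legendre_zero : legendre 0 = 1 := by simp [legendre]

lemma legendre_one : legendre 1 = X := by
  simp only [legendre, Function.iterate_one, pow_one, Nat.factorial_one, derivative_sub,
    derivative_X_pow, derivative_one, sub_zero]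
  rw [← mul_assoc, ← C_mul]
  norm_num

lemma legendre_succ_eval {a : ℝ} (ha : a ^ 2 = 1) (n : ℕ) :
    (legendre (n + 1)).eval a = a * (legendre n).eval a := by
  cases n with
  | zero => simp [legendre_zero, legendre_one]
  | succ n =>
    rw [legendre_succ_succ, eval_add, eval_mul, eval_mul,
      eval_iterate_derivative_eq_zero (by omega) ha]
    simp

lemma legendre_eval_one (n : ℕ) : (legendre n).eval 1 = 1 := by
  induction n with
  | zero => simp [legendre_zero]
  | succ n ih => rw [legendre_succ_eval (by norm_num), ih, one_mul]

lemma legendre_eval_neg_one_sq (n : ℕ) : (legendre n).eval (-1) ^ 2 = 1 := by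
  induction n with
  | zero => simp [legendre_zero]
  | succ n ih => rw [legendre_succ_eval (by norm_num), mul_pow, ih]; norm_num

lemma natDegree_legendre_le (n : ℕ) : (legendre n).natDegree ≤ n := by
  refine (natDegree_C_mul_le _ _).trans ((natDegree_iterate_derivative _ _).trans ?_)
  have : ((X ^ 2 - 1 : ℝ[X]) ^ n).natDegree ≤ n * 2 := by
    refine natDegree_pow_le_of_le n ?_
    compute_degree
  omega

lemma coeff_legendre (n : ℕ) :
    (legendre n).coeff n = ((2 * n).factorial : ℝ) / (2 ^ n * (n.factorial : ℝ) ^ 2) := by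
  have hm : (X ^ 2 - 1 : ℝ[X]).Monic := by
    have := monic_X_pow_sub_C (1 : ℝ) (two_ne_zero)
    simpa using this
  have hd : ((X ^ 2 - 1 : ℝ[X]) ^ n).natDegree = n + n := by
    rw [hm.natDegree_pow]
    have := natDegree_X_pow_sub_C (n := 2) (r := (1 : ℝ))
    rw [C_1] at this
    rw [this]; ring
  have h1 : ((X ^ 2 - 1 : ℝ[X]) ^ n).coeff (n + n) = 1 := by
    rw [← hd]; exact hm.pow n
  rw [legendre, coeff_C_mul, coeff_iterate_derivative, h1, nsmul_eq_mul, mul_one]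
  have h2 := Nat.factorial_mul_descFactorial (show n ≤ n + n by omega)
  rw [Nat.add_sub_cancel, ← two_mul] at h2
  rw [← two_mul, ← h2]
  push_cast
  field_simp

lemma coeff_legendre_pos (n : ℕ) : 0 < (legendre n).coeff n := by
  rw [coeff_legendre]; positivity

lemma natDegree_legendre (n : ℕ) : (legendre n).natDegree = n :=
  natDegree_eq_of_le_of_coeff_ne_zero (natDegree_legendre_le n) (coeff_legendre_pos n).ne'

lemma legendre_ne_zero (n : ℕ) : legendre n ≠ 0 := fun h => by
  have := coeff_legendre_pos n
  simp [h] at this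

lemma degree_legendre (n : ℕ) : (legendre n).degree = n := by
  rw [degree_eq_natDegree (legendre_ne_zero n), natDegree_legendre]

lemma leadingCoeff_legendre (n : ℕ) : (legendre n).leadingCoeff = (legendre n).coeff n := by
  rw [leadingCoeff, natDegree_legendre]

/-- Against `P_n`, a polynomial of degree at most `n` acts through its `n`-th coefficient. -/
lemma polyIntegral_legendre_mul_eq {n : ℕ} {g : ℝ[X]} (hg : g.degree ≤ n) :
    polyIntegral (legendre n * g) =
      g.coeff n / (legendre n).coeff n * polyIntegral (legendre n * legendre n) := by
  set c := g.coeff n / (legendre n).coeff n with hc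
  have h : polyIntegral (legendre n * (g - C c * legendre n)) = 0 := by
    refine polyIntegral_legendre_mul ?_
    rw [degree_lt_iff_coeff_zero]
    intro m hm
    rcases hm.eq_or_lt with rfl | hm
    · rw [coeff_sub, coeff_C_mul, hc, div_mul_cancel₀ _ (coeff_legendre_pos _).ne', sub_self]
    · rw [coeff_sub, coeff_C_mul, coeff_eq_zero_of_degree_lt (hg.trans_lt (by exact_mod_cast hm)),
        coeff_eq_zero_of_degree_lt ((degree_legendre n).trans_lt (by exact_mod_cast hm))]
      simp
  rw [mul_sub, map_sub, mul_left_comm, polyIntegral_C_mul] at h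
  linarith

/-- Integrate `(X * P_n ^ 2)'`: the boundary values are known, and `X * P_n'` has `n`-th coefficient
`n` times that of `P_n`, so it contributes a multiple of the same norm. -/
lemma polyIntegral_legendre_sq (n : ℕ) :
    polyIntegral (legendre n * legendre n) = 2 / (2 * (n : ℝ) + 1) := by
  have h1 : polyIntegral (legendre n * (X * derivative (legendre n))) =
      n * polyIntegral (legendre n * legendre n) := by
    rw [polyIntegral_legendre_mul_eq]
    · congr 1
      rw [div_eq_iff (coeff_legendre_pos n).ne']
      cases n with
      | zero => simp [legendre_zero]
      | succ n => rw [coeff_X_mul, coeff_derivative]; push_cast; ring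
    · refine degree_le_of_natDegree_le ?_
      cases n with
      | zero => simp [legendre_zero]
      | succ n =>
        refine natDegree_mul_le.trans ?_
        have := natDegree_derivative_le (legendre (n + 1))
        rw [natDegree_legendre] at this
        rw [natDegree_X]; omega
  have h2 : derivative (X * (legendre n * legendre n)) =
      legendre n * legendre n + C 2 * (legendre n * (X * derivative (legendre n))) := by
    simp only [derivative_mul, derivative_X, map_ofNat]; ring
  have h3 := polyIntegral_derivative (X * (legendre n * legendre n))
  have h4 := legendre_eval_neg_one_sq n
  rw [h2, map_add, polyIntegral_C_mul, h1] at h3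
  simp only [eval_mul, eval_X, legendre_eval_one] at h3
  rw [eq_div_iff (by positivity)]
  linear_combination h3 + h4

/-! ### Zeros of orthogonal polynomials -/

lemma eval_sign_of_forall_ne_zero {p : ℝ[X]} (h : ∀ x, p.eval x ≠ 0) :
    (∀ x, 0 ≤ p.eval x) ∨ ∀ x, p.eval x ≤ 0 := by
  by_contra! hc
  obtain ⟨⟨a, ha⟩, b, hb⟩ := hc
  obtain ⟨c, hc⟩ := mem_range_of_exists_le_of_exists_ge p.continuous ⟨a, ha.le⟩ ⟨b, hb.le⟩
  exact h c hc

/-- A polynomial orthogonal to all polynomials of lower degree, with respect to a nonnegative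
weight, has no nonconstant divisor of constant sign on `[-1, 1]`. -/
lemma not_dvd_of_orthogonal {p w ρ : ℝ[X]} {n : ℕ} (hp : p ≠ 0) (hpn : p.natDegree = n)
    (hw : w ≠ 0) (hw0 : ∀ x ∈ Set.Icc (-1 : ℝ) 1, 0 ≤ w.eval x)
    (horth : ∀ g : ℝ[X], g.degree < n → polyIntegral (w * p * g) = 0) (hρ : 0 < ρ.natDegree)
    (hsign : (∀ x ∈ Set.Icc (-1 : ℝ) 1, 0 ≤ ρ.eval x) ∨
      ∀ x ∈ Set.Icc (-1 : ℝ) 1, ρ.eval x ≤ 0) : ¬ ρ ∣ p := by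
  rintro ⟨g, rfl⟩
  have hρ0 : ρ ≠ 0 := left_ne_zero_of_mul hp
  have hg0 : g ≠ 0 := right_ne_zero_of_mul hp
  rw [natDegree_mul hρ0 hg0] at hpn
  have h1 := horth g ((natDegree_lt_iff_degree_lt hg0).1 (by omega))
  refine polyIntegral_ne_zero_of_sign (mul_ne_zero (mul_ne_zero hw hp) hg0) ?_ h1
  -- Testing orthogonality against the cofactor `g` leaves `w * g ^ 2 * ρ`, whose sign is that of
  -- `ρ`.
  have e : ∀ x, (w * (ρ * g) * g).eval x = (w.eval x * g.eval x ^ 2) * ρ.eval x := fun x => by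
    simp only [eval_mul]; ring
  refine hsign.imp (fun h x hx => ?_) (fun h x hx => ?_) <;> rw [e]
  · exact mul_nonneg (mul_nonneg (hw0 x hx) (sq_nonneg _)) (h x hx)
  · exact mul_nonpos_of_nonneg_of_nonpos (mul_nonneg (hw0 x hx) (sq_nonneg _)) (h x hx)

/-- The roots of an orthogonal polynomial are real, simple and interior. -/
lemma roots_of_orthogonal {p w : ℝ[X]} {n : ℕ} (hp : p ≠ 0) (hpn : p.natDegree = n)
    (hw : w ≠ 0) (hw0 : ∀ x ∈ Set.Icc (-1 : ℝ) 1, 0 ≤ w.eval x)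
    (horth : ∀ g : ℝ[X], g.degree < n → polyIntegral (w * p * g) = 0) :
    p.roots.toFinset.card = n ∧ (∀ x ∈ p.roots.toFinset, x ∈ Set.Ioo (-1 : ℝ) 1) ∧
      p = C p.leadingCoeff * ∏ a ∈ p.roots.toFinset, (X - C a) := by
  have hnot := fun ρ => not_dvd_of_orthogonal (ρ := ρ) hp hpn hw hw0 horth
  have hsplit : p.Splits := by
    obtain ⟨u, hu⟩ := UniqueFactorizationMonoid.factors_prod hp
    rw [← hu]
    refine (Splits.multisetProd fun q hqf => ?_).mul u.isUnit.splits
    have hq := UniqueFactorizationMonoid.irreducible_of_factor q hqf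
    refine Splits.of_degree_eq_one ?_
    -- A nonlinear irreducible factor has no real root, hence constant sign.
    by_contra hdeg
    refine hnot q hq.natDegree_pos ?_ (UniqueFactorizationMonoid.dvd_of_mem_factors hqf)
    refine (eval_sign_of_forall_ne_zero fun x hx => hdeg ?_).imp (fun h x _ => h x)
      (fun h x _ => h x)
    exact degree_eq_one_of_irreducible_of_root hq hx
  have hnodup : p.roots.Nodup := by
    rw [Multiset.nodup_iff_count_le_one]
    intro a
    by_contra! hc
    rw [count_roots] at hc
    have h2 : (X - C a) ^ 2 ∣ p := (pow_dvd_pow _ hc).trans (pow_rootMultiplicity_dvd p a)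
    refine hnot _ (by rw [natDegree_pow, natDegree_X_sub_C]; norm_num) (Or.inl fun x _ => ?_) h2
    simp only [eval_pow]; positivity
  refine ⟨?_, fun x hx => ?_, ?_⟩
  · rw [Multiset.toFinset_card_of_nodup hnodup, ← hpn]
    exact hsplit.natDegree_eq_card_roots.symm
  · rw [Multiset.mem_toFinset] at hx
    have hd := dvd_iff_isRoot.2 (isRoot_of_mem_roots hx)
    by_contra hc
    refine hnot _ (by simp) ?_ hd
    simp only [Set.mem_Ioo, not_and_or, not_lt] at hc
    simp only [eval_sub, eval_X, eval_C]
    exact hc.imp (fun h y hy => by linarith [hy.1]) (fun h y hy => by linarith [hy.2])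
  · conv_lhs => rw [hsplit.eq_prod_roots]
    congr 1
    rw [Finset.prod, Multiset.toFinset_val, hnodup.dedup]

lemma legendre_roots (n : ℕ) :
    (nodes n).card = n ∧ (∀ x ∈ nodes n, x ∈ Set.Ioo (-1 : ℝ) 1) ∧
      legendre n = C (legendre n).leadingCoeff * ∏ a ∈ nodes n, (X - C a) :=
  roots_of_orthogonal (w := 1) (legendre_ne_zero n) (natDegree_legendre n) one_ne_zero
    (by simp) (fun g hg => by rw [one_mul, polyIntegral_legendre_mul hg])

lemma isRoot_of_mem_nodes {n : ℕ} {x : ℝ} (hx : x ∈ nodes n) : (legendre n).eval x = 0 :=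
  isRoot_of_mem_roots (Multiset.mem_toFinset.1 hx)

/-! ### Exactness of the quadrature and its weights -/

/-- The interpolatory quadrature at the Legendre nodes is exact up to degree `2 * n - 1`. -/
lemma polyIntegral_eq_sum_basis {n : ℕ} {p : ℝ[X]} (hp : p.degree < (2 * n : ℕ)) :
    polyIntegral p =
      ∑ x ∈ nodes n, polyIntegral (Lagrange.basis (nodes n) id x) * p.eval x := by
  -- Division by `P_n`: the quotient has degree below `n`, so its part integrates to zero; the
  -- remainder agrees with `p` at the nodes and equals its own interpolant.
  set L := legendre n with hL
  have hdm := EuclideanDomain.div_add_mod p L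
  have hr : (p % L).degree < n := by
    rw [← degree_legendre n]
    exact EuclideanDomain.mod_lt p (legendre_ne_zero n)
  have hs : (p / L).degree < n := by
    by_cases h0 : p / L = 0
    · rw [h0, degree_zero]; exact WithBot.bot_lt_coe n
    have h1 : (L * (p / L)).degree < (2 * n : ℕ) := by
      have : L * (p / L) = p - p % L := by rw [eq_sub_iff_add_eq]; exact hdm
      rw [this]
      refine (degree_sub_le _ _).trans_lt (max_lt hp (hr.trans_le ?_))
      exact_mod_cast (by omega : n ≤ 2 * n)
    rw [← natDegree_lt_iff_degree_lt (mul_ne_zero (legendre_ne_zero n) h0),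
      natDegree_mul (legendre_ne_zero n) h0, natDegree_legendre] at h1
    exact (natDegree_lt_iff_degree_lt h0).1 (by omega)
  have hev : ∀ x ∈ nodes n, (p % L).eval x = p.eval x := fun x hx => by
    conv_rhs => rw [← hdm]
    rw [eval_add, eval_mul, isRoot_of_mem_nodes hx]; ring
  have hint := Lagrange.eq_interpolate (f := p % L) (s := nodes n) (v := id)
    Function.injective_id.injOn (by rw [(legendre_roots n).1]; exact hr)
  have h1 : polyIntegral p = polyIntegral (p % L) := by
    conv_lhs => rw [← hdm]
    rw [map_add, polyIntegral_legendre_mul hs, zero_add]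
  rw [h1, hint, Lagrange.interpolate_apply, map_sum]
  refine Finset.sum_congr rfl fun x hx => ?_
  rw [polyIntegral_C_mul, id, hev x hx, mul_comm]

/-- With `P = (X - x) * r`, the rule sees `r * r` and `r * P'` only at the node `x`, where `r` and
`P'` agree, so both integrals equal `l * r(x) ^ 2`. Integrating `(r * P)' = 2 r P' - r ^ 2` then
evaluates this number from the endpoint values of `P`. -/
lemma weight_eq {n : ℕ} {x : ℝ} (hx : x ∈ nodes (n + 1)) :
    polyIntegral (Lagrange.basis (nodes (n + 1)) id x) = weight (n + 1) x := by
  obtain ⟨r, hr⟩ := dvd_iff_isRoot.2 (isRoot_of_mem_nodes hx)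
  set P := legendre (n + 1) with hP
  set l := polyIntegral (Lagrange.basis (nodes (n + 1)) id x) with hl
  have hxI := (legendre_roots (n + 1)).2.1 x hx
  have hP0 : P ≠ 0 := legendre_ne_zero _
  have hr0 : r ≠ 0 := fun h => hP0 (by rw [hr, h, mul_zero])
  have hrd : r.natDegree = n := by
    have := natDegree_legendre (n + 1)
    rw [← hP, hr, natDegree_mul (X_sub_C_ne_zero x) hr0, natDegree_X_sub_C] at this
    omega
  have hdr : derivative P = r + (X - C x) * derivative r := by
    rw [hr, derivative_mul]; simp
  have hdx : (derivative P).eval x = r.eval x := by rw [hdr]; simp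
  have hother : ∀ y ∈ nodes (n + 1), y ≠ x → r.eval y = 0 := fun y hy hyx => by
    have := isRoot_of_mem_nodes hy
    rw [← hP, hr, eval_mul] at this
    simpa [sub_eq_zero, hyx] using this
  have hdeg : ∀ q : ℝ[X], q.natDegree ≤ n → (r * q).degree < (2 * (n + 1) : ℕ) := fun q hq => by
    refine degree_le_natDegree.trans_lt ?_
    have := natDegree_mul_le (p := r) (q := q)
    exact_mod_cast (by omega : (r * q).natDegree < 2 * (n + 1))
  have hsum : ∀ q : ℝ[X], q.natDegree ≤ n → polyIntegral (r * q) = l * (r.eval x * q.eval x) := by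
    intro q hq
    rw [polyIntegral_eq_sum_basis (hdeg q hq), Finset.sum_eq_single x]
    · rw [eval_mul]
    · intro y hy hyx
      rw [eval_mul, hother y hy hyx]; ring
    · exact fun h => absurd hx h
  have hrr := hsum r hrd.le
  have hrP := hsum (derivative P) (by
    have := natDegree_derivative_le P
    rw [hP, natDegree_legendre] at this; exact this)
  rw [hdx] at hrP
  have hparts : derivative (r * P) = C 2 * (r * derivative P) - r * r := by
    rw [derivative_mul, hdr, map_ofNat]
    conv_lhs => rw [hr]
    ring
  have hint := polyIntegral_derivative (r * P)
  rw [hparts, map_sub, polyIntegral_C_mul, hrr, hrP] at hint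
  have h1 : (1 - x) * r.eval 1 = 1 := by
    have := legendre_eval_one (n + 1)
    rw [← hP, hr] at this; simpa using this
  have h2 : ((-1 - x) * r.eval (-1)) ^ 2 = 1 := by
    have := legendre_eval_neg_one_sq (n + 1)
    rw [← hP, hr] at this; simpa using this
  have hx1 : (1 - x) ≠ 0 := by linarith [hxI.2]
  have hx2 : (-1 - x) ≠ 0 := by linarith [hxI.1]
  -- The boundary terms are `1 / (1 - x)` and `-1 / (1 + x)`, with difference `2 / (1 - x ^ 2)`.
  have hk : l * (r.eval x) ^ 2 * (1 - x ^ 2) = 2 := by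
    have e1 : (r * P).eval 1 * (1 - x) = 1 := by
      rw [eval_mul, hP, legendre_eval_one]; linarith
    have e2 : (r * P).eval (-1) * (-1 - x) = 1 := by
      rw [eval_mul, hr, eval_mul]; simp only [eval_sub, eval_X, eval_C]; linear_combination h2
    linear_combination (1 - x ^ 2) * hint + (1 + x) * e1 + (1 - x) * e2
  have hrec := congrArg (eval x) (sq_sub_one_mul_derivative_legendre n)
  simp only [eval_mul, eval_sub, eval_pow, eval_X, eval_one, eval_C] at hrec
  rw [← hP, hdx, isRoot_of_mem_nodes hx] at hrec
  have hx3 : (1 - x ^ 2) ≠ 0 := by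
    have : (1 - x ^ 2) = - ((1 - x) * (-1 - x)) := by ring
    rw [this]; exact neg_ne_zero.2 (mul_ne_zero hx1 hx2)
  have hrx : r.eval x ≠ 0 := fun h => by rw [h] at hk; norm_num at hk
  have hrec2 : ((n : ℝ) + 2) * (legendre (n + 2)).eval x = (x ^ 2 - 1) * r.eval x := by
    rw [hrec]; ring
  have hsq : (((n + 1 : ℕ) : ℝ) + 1) ^ 2 * ((legendre (n + 1 + 1)).eval x) ^ 2 =
      ((x ^ 2 - 1) * r.eval x) ^ 2 := by
    rw [← hrec2]; push_cast; ring
  have hx4 : x ^ 2 - 1 ≠ 0 := by rw [← neg_sub]; exact neg_ne_zero.2 hx3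
  rw [weight, hsq, eq_div_iff (pow_ne_zero 2 (mul_ne_zero hx4 hrx))]
  linear_combination (1 - x ^ 2) * hk

lemma weight_nonneg {n : ℕ} {x : ℝ} (hx : x ∈ nodes n) : 0 ≤ weight n x := by
  have hxI := (legendre_roots n).2.1 x hx
  have : 0 ≤ 1 - x ^ 2 := by nlinarith [hxI.1, hxI.2]
  rw [weight]; positivity

/-- The Gauss–Legendre quadrature is exact up to degree `2 * N - 1`. -/
theorem gaussQuad_eq_polyIntegral {N : ℕ} {p : ℝ[X]} (hp : p.degree < (2 * N : ℕ)) :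
    gaussQuad N (fun x => p.eval x) = polyIntegral p := by
  rw [polyIntegral_eq_sum_basis hp, gaussQuad]
  cases N with
  | zero =>
    have : p = 0 := by simpa using hp
    simp [this]
  | succ n => exact Finset.sum_congr rfl fun x hx => by rw [weight_eq hx]

/-! ### Rolle's theorem and the interpolation remainder -/

/-- Iterated Rolle theorem: a `C^m` function on an interval with `m + 1` zeros has a zero of its
`m`-th derivative. -/
lemma exists_iteratedDerivWithin_eq_zero {a b : ℝ} (hab : a < b) (m : ℕ) (g : ℝ → ℝ)
    (hg : ContDiffOn ℝ m g (Set.Icc a b)) (x : Fin (m + 1) → ℝ) (hx : StrictMono x)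
    (hxI : ∀ i, x i ∈ Set.Icc a b) (hx0 : ∀ i, g (x i) = 0) :
    ∃ c ∈ Set.Icc a b, iteratedDerivWithin m g (Set.Icc a b) c = 0 := by
  induction m generalizing g with
  | zero => exact ⟨x 0, hxI 0, by simp [hx0]⟩
  | succ m ih =>
    have hu := uniqueDiffOn_Icc hab
    have hstep : ∀ i : Fin (m + 1), ∃ c ∈ Set.Ioo (x i.castSucc) (x i.succ), deriv g c = 0 := by
      intro i
      refine exists_deriv_eq_zero (hx Fin.castSucc_lt_succ) (hg.continuousOn.mono ?_) ?_
      · exact Set.Icc_subset_Icc (hxI _).1 (hxI _).2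
      · rw [hx0, hx0]
    choose c hc hc0 using hstep
    have hcI : ∀ i, c i ∈ Set.Ioo a b := fun i =>
      ⟨(hxI _).1.trans_lt (hc i).1, (hc i).2.trans_le (hxI _).2⟩
    have hmono : StrictMono c := by
      rw [Fin.strictMono_iff_lt_succ]
      intro i
      refine (hc i.castSucc).2.trans ?_
      have := (hc i.succ).1
      rwa [← Fin.succ_castSucc] at this
    rw [iteratedDerivWithin_succ']
    refine ih _ (hg.derivWithin hu (by push_cast; exact le_rfl)) c hmono
      (fun i => Set.Ioo_subset_Icc_self (hcI i)) (fun i => ?_)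
    rw [derivWithin_of_mem_nhds (Icc_mem_nhds (hcI i).1 (hcI i).2), hc0]

lemma iteratedDerivWithin_eval {s : Set ℝ} (hs : UniqueDiffOn ℝ s) (p : ℝ[X]) (m : ℕ) {x : ℝ}
    (hx : x ∈ s) :
    iteratedDerivWithin m (fun y => p.eval y) s x = (derivative^[m] p).eval x := by
  induction m generalizing x with
  | zero => simp
  | succ m ih =>
    rw [iteratedDerivWithin_succ, derivWithin_congr (fun y hy => ih hy) (ih hx),
      Function.iterate_succ_apply', Polynomial.derivWithin _ (hs x hx)]

lemma iterate_derivative_natDegree_of_monic {p : ℝ[X]} (hp : p.Monic) :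
    derivative^[p.natDegree] p = C (p.natDegree.factorial : ℝ) := by
  have h1 := natDegree_iterate_derivative p p.natDegree
  rw [Nat.sub_self, Nat.le_zero] at h1
  rw [eq_C_of_natDegree_eq_zero h1, coeff_iterate_derivative, zero_add, Nat.descFactorial_self,
    hp.coeff_natDegree]
  simp

/-- The remainder of Lagrange interpolation at the nodes `T`. -/
lemma abs_sub_interpolate_le {a b : ℝ} (hab : a < b) {f : ℝ → ℝ} {k : ℕ} {M : ℝ}
    (hf : ContDiffOn ℝ k f (Set.Icc a b))
    (hM : ∀ x ∈ Set.Icc a b, |iteratedDerivWithin k f (Set.Icc a b) x| ≤ M)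
    {T : Finset ℝ} (hT : T.card = k) (hTI : ∀ x ∈ T, x ∈ Set.Icc a b) {x : ℝ}
    (hx : x ∈ Set.Icc a b) :
    |f x - (Lagrange.interpolate T id f).eval x| ≤ M / k.factorial * |∏ y ∈ T, (x - y)| := by
  set H := Lagrange.interpolate T id f with hH
  have hHT : ∀ y ∈ T, H.eval y = f y := fun y hy =>
    Lagrange.eval_interpolate_at_node (v := id) f Function.injective_id.injOn hy
  by_cases hxT : x ∈ T
  · rw [hHT x hxT, sub_self, abs_zero, Finset.prod_eq_zero hxT (sub_self x)]
    simp
  have hu := uniqueDiffOn_Icc hab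
  set Q := Lagrange.nodal T (id : ℝ → ℝ) with hQ
  have hQx : Q.eval x = ∏ y ∈ T, (x - y) := Lagrange.eval_nodal
  have hQx0 : Q.eval x ≠ 0 := by
    rw [hQx, Finset.prod_ne_zero_iff]
    exact fun y hy h => hxT (by rwa [sub_eq_zero.1 h])
  -- This `c` makes `R` agree with `f` at `x` too, giving `k + 1` zeros of `f - R`; Rolle then
  -- yields `f^(k)(ξ) = c * k!`.
  set c := (f x - H.eval x) / Q.eval x with hc
  set R := H + C c * Q with hR
  have hRf : ∀ y ∈ insert x T, f y - R.eval y = 0 := by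
    intro y hy
    rcases Finset.mem_insert.1 hy with rfl | hy
    · rw [hR, eval_add, eval_mul, eval_C, hc, div_mul_cancel₀ _ hQx0]; ring
    · have hq : Q.eval y = 0 := Lagrange.eval_nodal_at_node (v := id) hy
      rw [hR, eval_add, eval_mul, hq, hHT y hy]; ring
  have hcard : (insert x T).card = k + 1 := by rw [Finset.card_insert_of_notMem hxT, hT]
  have hRc : ContDiffOn ℝ k (fun y => R.eval y) (Set.Icc a b) := by
    simpa using (R.contDiff_aeval (𝕜 := ℝ) k).contDiffOn
  obtain ⟨ξ, hξ, h0⟩ := exists_iteratedDerivWithin_eq_zero hab k (f - fun y => R.eval y)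
    (hf.sub hRc) _ ((insert x T).orderEmbOfFin hcard).strictMono
    (fun i => by
      rcases Finset.mem_insert.1 ((insert x T).orderEmbOfFin_mem hcard i) with h | h
      · rw [h]; exact hx
      · exact hTI _ h)
    (fun i => hRf _ ((insert x T).orderEmbOfFin_mem hcard i))
  have hQd : derivative^[k] Q = C (k.factorial : ℝ) := by
    have h1 : Q.natDegree = k := by rw [hQ, Lagrange.natDegree_nodal, hT]
    have h2 := iterate_derivative_natDegree_of_monic (Lagrange.nodal_monic (s := T) (v := id))
    rwa [← hQ, h1] at h2
  have hHd : derivative^[k] H = 0 := by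
    refine iterate_derivative_eq_zero_of_degree_lt ?_
    rw [← hT]
    exact Lagrange.degree_interpolate_lt _ Function.injective_id.injOn
  rw [iteratedDerivWithin_sub hξ hu (hf ξ hξ) (hRc ξ hξ), iteratedDerivWithin_eval hu _ _ hξ, hR,
    iterate_map_add, iterate_derivative_C_mul, hQd, hHd] at h0
  simp only [zero_add, eval_mul, eval_C] at h0
  have hb := hM ξ hξ
  rw [sub_eq_zero.1 h0, abs_mul, Nat.abs_cast] at hb
  have hcM : |c| ≤ M / k.factorial := by
    rw [le_div_iff₀ (by positivity)]; exact hb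
  calc |f x - H.eval x| = |c| * |Q.eval x| := by
        rw [← abs_mul, hc, div_mul_cancel₀ _ hQx0]
    _ ≤ _ := by rw [hQx]; gcongr

/-! ### Quadrature error in terms of the nodal polynomial -/

lemma gaussQuad_sub (N : ℕ) (f g : ℝ → ℝ) :
    gaussQuad N (fun x => f x - g x) = gaussQuad N f - gaussQuad N g := by
  simp only [gaussQuad, mul_sub, Finset.sum_sub_distrib]

lemma abs_gaussQuad_le {N : ℕ} {f g : ℝ → ℝ} (h : ∀ x ∈ Set.Icc (-1 : ℝ) 1, |f x| ≤ g x) :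
    |gaussQuad N f| ≤ gaussQuad N g := by
  refine (Finset.abs_sum_le_sum_abs _ _).trans (Finset.sum_le_sum fun x hx => ?_)
  rw [abs_mul, abs_of_nonneg (weight_nonneg hx)]
  exact mul_le_mul_of_nonneg_left
    (h x (Set.Ioo_subset_Icc_self ((legendre_roots N).2.1 x hx))) (weight_nonneg hx)

/-- The quadrature error bound coming from interpolation at distinct nodes. -/
lemma abs_error_le_of_nodes {f : ℝ → ℝ} {k N : ℕ} {M : ℝ} (hkN : k ≤ 2 * N)
    (hf : ContDiffOn ℝ k f (Set.Icc (-1) 1))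
    (hM : ∀ x ∈ Set.Icc (-1 : ℝ) 1, |iteratedDerivWithin k f (Set.Icc (-1) 1) x| ≤ M)
    {T : Finset ℝ} (hT : T.card = k) (hTI : ∀ x ∈ T, x ∈ Set.Icc (-1 : ℝ) 1) :
    |(∫ x in (-1 : ℝ)..1, f x) - gaussQuad N f| ≤
      M / k.factorial * ((∫ x in (-1 : ℝ)..1, |∏ y ∈ T, (x - y)|) +
        gaussQuad N (fun x => |∏ y ∈ T, (x - y)|)) := by
  set H := Lagrange.interpolate T id f with hH
  have hrem : ∀ x ∈ Set.Icc (-1 : ℝ) 1, |f x - H.eval x| ≤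
      M / k.factorial * |∏ y ∈ T, (x - y)| := fun x hx =>
    abs_sub_interpolate_le (by norm_num) hf hM hT hTI hx
  have hHd : H.degree < (2 * N : ℕ) := by
    refine (Lagrange.degree_interpolate_lt f Function.injective_id.injOn).trans_le ?_
    rw [hT]; exact_mod_cast hkN
  have hfi : IntervalIntegrable f MeasureTheory.volume (-1) 1 :=
    hf.continuousOn.intervalIntegrable_of_Icc (by norm_num)
  have hHi : IntervalIntegrable (fun x => H.eval x) MeasureTheory.volume (-1) 1 :=
    H.continuous.intervalIntegrable _ _
  have hqc : Continuous fun x : ℝ => M / k.factorial * |∏ y ∈ T, (x - y)| := by fun_prop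
  have h1 : |∫ x in (-1 : ℝ)..1, (f x - H.eval x)| ≤
      ∫ x in (-1 : ℝ)..1, M / k.factorial * |∏ y ∈ T, (x - y)| :=
    (intervalIntegral.abs_integral_le_integral_abs (by norm_num)).trans
      (intervalIntegral.integral_mono_on (by norm_num) (hfi.sub hHi).abs
        (hqc.intervalIntegrable _ _) hrem)
  have h2 := abs_gaussQuad_le (N := N) hrem
  have h3 : gaussQuad N (fun x => M / k.factorial * |∏ y ∈ T, (x - y)|) =
      M / k.factorial * gaussQuad N (fun x => |∏ y ∈ T, (x - y)|) := by
    simp only [gaussQuad, Finset.mul_sum]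
    exact Finset.sum_congr rfl fun x _ => by ring
  rw [intervalIntegral.integral_sub hfi hHi, intervalIntegral.integral_const_mul] at h1
  rw [gaussQuad_sub, h3, gaussQuad_eq_polyIntegral hHd, polyIntegral_apply] at h2
  rw [mul_add]
  refine le_trans ?_ (add_le_add h1 h2)
  refine le_trans (le_of_eq ?_) (abs_sub _ _)
  congr 1; ring

open Filter Topology in
/-- The quadrature error bound coming from interpolation with double nodes `s` and simple nodes
`t`. -/
lemma abs_error_le_of_double_nodes {f : ℝ → ℝ} {k N : ℕ} {M : ℝ} (hkN : k < 2 * N)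
    (hf : ContDiffOn ℝ k f (Set.Icc (-1) 1))
    (hM : ∀ x ∈ Set.Icc (-1 : ℝ) 1, |iteratedDerivWithin k f (Set.Icc (-1) 1) x| ≤ M)
    {s t : Finset ℝ} (hst : Disjoint s t) (hk : 2 * s.card + t.card = k)
    (hs : ∀ x ∈ s, x ∈ Set.Ioo (-1 : ℝ) 1) (ht : ∀ x ∈ t, x ∈ Set.Icc (-1 : ℝ) 1)
    (ht0 : ∀ x ∈ Set.Icc (-1 : ℝ) 1, 0 ≤ ∏ y ∈ t, (x - y)) :
    |(∫ x in (-1 : ℝ)..1, f x) - gaussQuad N f| ≤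
      M / k.factorial * (2 * polyIntegral ((∏ y ∈ s, (X - C y)) ^ 2 * ∏ y ∈ t, (X - C y))) := by
  set Q : ℝ[X] := (∏ y ∈ s, (X - C y)) ^ 2 * ∏ y ∈ t, (X - C y) with hQ
  -- Absolute value of the nodal polynomial with each double node split into `y` and `y + ε`; at `ε
  -- = 0` it is `Q` itself on `[-1, 1]`.
  let q : ℝ → ℝ → ℝ := fun ε x => |(∏ y ∈ s, (x - y)) * (∏ y ∈ s, (x - (y + ε))) *
    ∏ y ∈ t, (x - y)|
  have hq : Continuous (Function.uncurry q) := by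
    simp only [q, Function.uncurry_def]; fun_prop
  let B : ℝ → ℝ := fun ε => M / k.factorial * ((∫ x in (-1 : ℝ)..1, q ε x) + gaussQuad N (q ε))
  have hB : Continuous B := by
    refine continuous_const.mul (Continuous.add ?_ ?_)
    · exact intervalIntegral.continuous_parametric_intervalIntegral_of_continuous' hq _ _
    · simp only [gaussQuad, q]; fun_prop
  have hq0 : ∀ x ∈ Set.Icc (-1 : ℝ) 1, q 0 x = Q.eval x := by
    intro x hx
    have e : Q.eval x = (∏ y ∈ s, (x - y)) * (∏ y ∈ s, (x - (y + 0))) * ∏ y ∈ t, (x - y) := by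
      simp only [hQ, eval_mul, eval_pow, eval_prod, eval_sub, eval_X, eval_C, add_zero]; ring
    rw [e]
    refine abs_of_nonneg (mul_nonneg ?_ (ht0 x hx))
    simp only [add_zero]; exact mul_self_nonneg _
  have hQd : Q.degree < (2 * N : ℕ) := by
    have h1 : Q.degree = k := by
      rw [hQ, degree_mul, degree_pow, degree_prod_of_monic _ _ (fun y _ => monic_X_sub_C y),
        degree_prod_of_monic _ _ (fun y _ => monic_X_sub_C y)]
      simp only [degree_X_sub_C, Finset.sum_const, nsmul_eq_mul, mul_one, ← hk]
      push_cast; rfl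
    rw [h1]; exact_mod_cast hkN
  have hB0 : B 0 = M / k.factorial * (2 * polyIntegral Q) := by
    have h1 : (∫ x in (-1 : ℝ)..1, q 0 x) = polyIntegral Q := by
      rw [polyIntegral_apply]
      refine intervalIntegral.integral_congr fun x hx => hq0 x ?_
      rwa [Set.uIcc_of_le (by norm_num)] at hx
    have h2 : gaussQuad N (q 0) = polyIntegral Q := by
      rw [← gaussQuad_eq_polyIntegral hQd]
      refine Finset.sum_congr rfl fun x hx => ?_
      rw [hq0 x (Set.Ioo_subset_Icc_self ((legendre_roots N).2.1 x hx))]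
    simp only [B, h1, h2, two_mul]
  rw [← hB0]
  -- The bound `B ε` holds for all small `ε > 0`, where the shifted nodes stay below `1` and are
  -- distinct from the others; continuity of `B` passes it to `B 0`.
  refine ge_of_tendsto (hB.continuousAt.tendsto.mono_left (nhdsWithin_le_nhds (s := Set.Ioi 0))) ?_
  have hsmall : ∀ᶠ ε in 𝓝[>] (0 : ℝ), ∀ y ∈ s, y + ε < 1 := by
    rw [Filter.eventually_all_finset]
    intro y hy
    have : ∀ᶠ ε in 𝓝 (0 : ℝ), y + ε < 1 :=
      (continuous_const.add continuous_id).continuousAt.eventually_lt_const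
        (by simpa using (hs y hy).2)
    exact this.filter_mono nhdsWithin_le_nhds
  have hdisj : ∀ᶠ ε in 𝓝[>] (0 : ℝ), ∀ y ∈ s, ∀ z ∈ s ∪ t, y + ε ≠ z := by
    rw [Filter.eventually_all_finset]
    intro y hy
    rw [Filter.eventually_all_finset]
    intro z hz
    by_cases hyz : y = z
    · filter_upwards [self_mem_nhdsWithin] with ε hε h
      have : (0 : ℝ) < ε := hε
      linarith
    · have : ∀ᶠ ε in 𝓝 (0 : ℝ), y + ε ≠ z :=
        (continuous_const.add continuous_id).continuousAt.eventually_ne (by simpa using hyz)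
      exact this.filter_mono nhdsWithin_le_nhds
  filter_upwards [hsmall, hdisj, self_mem_nhdsWithin] with ε h1 h2 h3
  have hε : 0 < ε := h3
  have hinj : Function.Injective fun y : ℝ => y + ε := add_left_injective ε
  have hd1 : Disjoint s (s.image fun y => y + ε) := by
    rw [Finset.disjoint_right]
    intro z hz hz'
    obtain ⟨y, hy, rfl⟩ := Finset.mem_image.1 hz
    exact h2 y hy _ (Finset.mem_union_left _ hz') rfl
  have hd2 : Disjoint (s ∪ s.image fun y => y + ε) t := by
    rw [Finset.disjoint_union_left]
    refine ⟨hst, ?_⟩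
    rw [Finset.disjoint_left]
    intro z hz hz'
    obtain ⟨y, hy, rfl⟩ := Finset.mem_image.1 hz
    exact h2 y hy _ (Finset.mem_union_right _ hz') rfl
  have hprod : ∀ x : ℝ, |∏ y ∈ (s ∪ s.image fun y => y + ε) ∪ t, (x - y)| = q ε x := by
    intro x
    rw [Finset.prod_union hd2, Finset.prod_union hd1, Finset.prod_image hinj.injOn]
  have key := abs_error_le_of_nodes (N := N) (T := (s ∪ s.image fun y => y + ε) ∪ t) hkN.le hf hM
    (by rw [Finset.card_union_of_disjoint hd2, Finset.card_union_of_disjoint hd1,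
          Finset.card_image_of_injective _ hinj, ← hk]; ring)
    (fun x hx => by
      rcases Finset.mem_union.1 hx with hx | hx
      · rcases Finset.mem_union.1 hx with hx | hx
        · exact Set.Ioo_subset_Icc_self (hs x hx)
        · obtain ⟨y, hy, rfl⟩ := Finset.mem_image.1 hx
          exact ⟨by linarith [(hs y hy).1], (h1 y hy).le⟩
      · exact ht x hx)
  simp only [hprod] at key
  exact key

/-! ### The two optimal node choices and the constants -/

/-- The bound for an even number of derivatives. -/
lemma abs_error_le_alphaEven {f : ℝ → ℝ} {n N : ℕ} {M : ℝ} (hN : n < N)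
    (hf : ContDiffOn ℝ (2 * n : ℕ) f (Set.Icc (-1) 1))
    (hM : ∀ x ∈ Set.Icc (-1 : ℝ) 1, |iteratedDerivWithin (2 * n) f (Set.Icc (-1) 1) x| ≤ M) :
    |(∫ x in (-1 : ℝ)..1, f x) - gaussQuad N f| ≤ alphaEven n * M := by
  obtain ⟨hcard, hI, hfac⟩ := legendre_roots n
  have h := abs_error_le_of_double_nodes (N := N) (s := nodes n) (t := ∅) (by omega) hf hM
    (by simp) (by simp [hcard]) hI (by simp) (by simp)
  refine h.trans (le_of_eq ?_)
  have hc := coeff_legendre_pos n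
  have hint := polyIntegral_legendre_sq n
  rw [leadingCoeff_legendre] at hfac
  set c := (legendre n).coeff n with hcdef
  set D : ℝ[X] := ∏ a ∈ nodes n, (X - C a) with hD
  have e : legendre n * legendre n = C (c ^ 2) * D ^ 2 := by rw [hfac, C_pow]; ring
  rw [e, polyIntegral_C_mul] at hint
  have hI' : polyIntegral (D ^ 2) = 2 / (2 * (n : ℝ) + 1) / c ^ 2 := by
    rw [eq_div_iff (by positivity), mul_comm]; exact hint
  rw [Finset.prod_empty, mul_one, hI', hcdef, coeff_legendre, alphaEven]
  have h4 : (4 : ℝ) ^ (n + 1) = 4 * (2 ^ n) ^ 2 := by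
    rw [pow_succ, ← pow_mul, mul_comm n 2, pow_mul]; norm_num; ring
  rw [h4]
  field_simp
  ring

/-- The Gauss–Radau nodal polynomial without its node at `-1`. -/
lemma exists_radau (n : ℕ) : ∃ S : ℝ[X],
    legendre n + legendre (n + 1) = (X - C (-1)) * S ∧ S.natDegree = n ∧
      S.coeff n = (legendre (n + 1)).coeff (n + 1) := by
  have hroot : (legendre n + legendre (n + 1)).IsRoot (-1) := by
    rw [IsRoot.def, eval_add, legendre_succ_eval (by norm_num)]; ring
  obtain ⟨S, hS⟩ := dvd_iff_isRoot.2 hroot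
  have hdlt : (legendre n).natDegree < (legendre (n + 1)).natDegree := by
    rw [natDegree_legendre, natDegree_legendre]; omega
  have hd : (legendre n + legendre (n + 1)).natDegree = n + 1 := by
    rw [natDegree_add_eq_right_of_natDegree_lt hdlt, natDegree_legendre]
  have hS0 : S ≠ 0 := by
    rintro rfl
    rw [hS, mul_zero, natDegree_zero] at hd
    omega
  have hSd : S.natDegree = n := by
    rw [hS, natDegree_mul (X_sub_C_ne_zero _) hS0, natDegree_X_sub_C] at hd
    omega
  refine ⟨S, hS, hSd, ?_⟩
  have h1 := congrArg leadingCoeff hS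
  rw [leadingCoeff_mul, leadingCoeff_X_sub_C, one_mul, leadingCoeff, hd, coeff_add,
    leadingCoeff, hSd, coeff_eq_zero_of_natDegree_lt (by rw [natDegree_legendre]; omega),
    zero_add] at h1
  exact h1.symm

/-- The bound for an odd number of derivatives. -/
lemma abs_error_le_alphaOdd {f : ℝ → ℝ} {n N : ℕ} {M : ℝ} (hN : n < N)
    (hf : ContDiffOn ℝ (2 * n + 1 : ℕ) f (Set.Icc (-1) 1))
    (hM : ∀ x ∈ Set.Icc (-1 : ℝ) 1, |iteratedDerivWithin (2 * n + 1) f (Set.Icc (-1) 1) x| ≤ M) :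
    |(∫ x in (-1 : ℝ)..1, f x) - gaussQuad N f| ≤ alphaOdd n * M := by
  obtain ⟨S, hS, hSd, hSc⟩ := exists_radau n
  have hc := coeff_legendre_pos n
  have hc' := coeff_legendre_pos (n + 1)
  have hS0 : S ≠ 0 := by
    rintro rfl
    rw [coeff_zero] at hSc
    exact hc'.ne hSc
  -- For the weight `x + 1`, orthogonality of `S` is that of `P_n + P_{n+1}` for the weight `1`;
  -- hence the zeros of `S` are simple and interior.
  have horth : ∀ g : ℝ[X], g.degree < n → polyIntegral ((X - C (-1)) * S * g) = 0 := by
    intro g hg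
    rw [← hS, add_mul, map_add, polyIntegral_legendre_mul hg, polyIntegral_legendre_mul
      (hg.trans (by exact_mod_cast Nat.lt_succ_self n)), add_zero]
  obtain ⟨hcard, hI, hfac⟩ := roots_of_orthogonal hS0 hSd (X_sub_C_ne_zero (-1))
    (fun x hx => by simp only [eval_sub, eval_X, eval_C]; linarith [hx.1]) horth
  set s := S.roots.toFinset with hs
  have h := abs_error_le_of_double_nodes (N := N) (s := s) (t := {-1}) (by omega) hf hM
    (by
      rw [Finset.disjoint_singleton_right]
      exact fun h => lt_irrefl _ (hI _ h).1)
    (by rw [hcard, Finset.card_singleton]) hI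
    (by simp)
    (fun x hx => by rw [Finset.prod_singleton]; linarith [hx.1])
  refine h.trans (le_of_eq ?_)
  -- Since `S` has degree `n`, `P_{n+1}` contributes nothing, and `P_n` sees only the leading
  -- coefficient of `S`.
  have hint : polyIntegral ((legendre n + legendre (n + 1)) * S) =
      S.coeff n / (legendre n).coeff n * (2 / (2 * (n : ℝ) + 1)) := by
    have hdeg : S.degree ≤ n := degree_le_of_natDegree_le hSd.le
    rw [add_mul, map_add, polyIntegral_legendre_mul_eq hdeg, polyIntegral_legendre_sq,
      polyIntegral_legendre_mul (hdeg.trans_lt (by exact_mod_cast Nat.lt_succ_self n)), add_zero]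
  rw [leadingCoeff, hSd] at hfac
  rw [hS] at hint
  set D : ℝ[X] := ∏ a ∈ s, (X - C a) with hD
  -- Here `S.coeff n` is the leading coefficient of `P_{n+1}`; one of its two powers cancels against
  -- `hint`, leaving the product of two Legendre leading coefficients in `hI'`.
  have e : (X - C (-1)) * S * S = C (S.coeff n ^ 2) * (D ^ 2 * (X - C (-1))) := by
    conv_lhs => rw [hfac]
    rw [C_pow]; ring
  rw [e, polyIntegral_C_mul, hSc] at hint
  have hI' : polyIntegral (D ^ 2 * (X - C (-1))) =
      2 / (2 * (n : ℝ) + 1) / ((legendre n).coeff n * (legendre (n + 1)).coeff (n + 1)) := by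
    field_simp
    field_simp at hint
    linarith
  have h4 : (4 : ℝ) ^ (n + 1) = 4 * (2 ^ n) ^ 2 := by
    rw [pow_succ, ← pow_mul, mul_comm n 2, pow_mul]; norm_num; ring
  rw [Finset.prod_singleton, hI', coeff_legendre, coeff_legendre, alphaOdd, h4,
    show 2 * (n + 1) = 2 * n + 1 + 1 by ring]
  simp only [Nat.factorial_succ, pow_succ (2 : ℝ) n]
  push_cast
  field_simp
  ring

lemma abs_le_supNorm {g : ℝ → ℝ} (hg : ContinuousOn g (Set.Icc (-1) 1)) {x : ℝ}
    (hx : x ∈ Set.Icc (-1 : ℝ) 1) : |g x| ≤ supNorm g :=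
  le_csSup (isCompact_Icc.image_of_continuousOn hg.abs).bddAbove ⟨x, hx, rfl⟩

end GaussLegendre

theorem mainTheorem7 (k N : ℕ) (hk : 2 ≤ k) (hN : k / 2 < N) :
    (k : ℤ) ≤ 2 * (N : ℤ) - 1 ∧
    ∀ f : ℝ → ℝ, ContDiffOn ℝ (k : ℕ∞) f (Set.Icc (-1 : ℝ) 1) →
      |(∫ x in (-1 : ℝ)..1, f x) - GaussLegendre.gaussQuad N f| ≤
        GaussLegendre.alpha k *
          GaussLegendre.supNorm (iteratedDerivWithin k f (Set.Icc (-1 : ℝ) 1)) := by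
  refine ⟨by omega, fun f hf => ?_⟩
  have hM : ∀ x ∈ Set.Icc (-1 : ℝ) 1, |iteratedDerivWithin k f (Set.Icc (-1) 1) x| ≤
      GaussLegendre.supNorm (iteratedDerivWithin k f (Set.Icc (-1 : ℝ) 1)) := fun x hx =>
    GaussLegendre.abs_le_supNorm
      (hf.continuousOn_iteratedDerivWithin le_rfl (uniqueDiffOn_Icc (by norm_num))) hx
  rw [GaussLegendre.alpha]
  split_ifs with he
  · obtain ⟨n, rfl⟩ := he.two_dvd
    rw [Nat.mul_div_cancel_left n two_pos] at hN ⊢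
    exact GaussLegendre.abs_error_le_alphaEven hN hf hM
  · obtain ⟨n, rfl⟩ := Nat.not_even_iff_odd.1 he
    have h2 : (2 * n + 1) / 2 = n := by omega
    rw [h2] at hN ⊢
    exact GaussLegendre.abs_error_le_alphaOdd hN hf hM
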